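/- For a Dedekind domain $D$, let $\mathcal{P}(D)$ be the set of all proper ideals of $D$ that are the radical of a nonzero principal ideal of $D$, partially ordered by inclusion; let $\mathrm{Cl}(D)$ be the class group of $D$, and let $T(D)$ be the torsion subgroup of $\mathrm{Cl}(D)$. Let $D$ and $D'$ be Dedekind domains. If $\mathcal{P}(D)$ and $\mathcal{P}(D')$ are isomorphic as partially ordered sets, and if the groups $\mathrm{Cl}(D)$ and $\mathrm{Cl}(D')$ are finitely generated, then there is a group isomorphism $\mathrm{Cl}(D)/T(D)\simeq\mathrm{Cl}(D')/T(D')$. -/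

import Mathlib

/-- The poset (ordered by inclusion) of the proper ideals of `D` that are the radical of a nonzero
principal ideal of `D`. The unit ideal, i.e. the radical of the ideal generated by a unit, is
excluded, so that this meet-semilattice has no unit element. -/
def principalRadicals (D : Type*) [CommRing D] : Set (Ideal D) :=
  {I | I ≠ ⊤ ∧ ∃ x : D, x ≠ 0 ∧ I = (Ideal.span {x}).radical}

/-! A principal radical is determined by the finite set of primes containing it. By clearing
denominators and killing torsion with a power, a finite set S of primes arises this way iff the
classes of its members, in the rational vector space V = Cl(D) ⊗ ℚ, satisfy a linear relation with
positive coefficients exactly on S. So the poset is, reversed, that of nonempty positively dependent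
sets (`nonempty_principalRadicals_orderIso`).

Let r(S) be the dimension of the space of relations supported in S. It strictly increases along
inclusions of such sets, and facets of the cone of nonnegative relations drop it by at most one, so
r is an order invariant (`finrank_relations_le_orderIso`). Always r(S ∪ T) ≤ r(S) + r(T) + dim V,
with equality for disjoint spanning S and T; these exist because every ideal class contains ideals
prime to a given finite set. As unions are joins, dim V, the rank of Cl(D), is read off the poset.
-/

open Module IsDedekindDomain

/-! ### Positive linear relations and their dimensions -/

section PositiveDependence

variable {M V : Type*} [AddCommGroup V] [Module ℚ V]

/-- A finite set `S` of indices is positively dependent for `v` if some linear relation between the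
vectors `v m` has positive coefficients at `m ∈ S` and vanishes elsewhere. -/
def PosDep (v : M → V) (S : Finset M) : Prop :=
  ∃ a : M →₀ ℚ, (∀ m, 0 ≤ a m) ∧ a.support = S ∧ Finsupp.linearCombination ℚ v a = 0

/-- The space of linear relations between the vectors `v m`, for `m ∈ S`. -/
noncomputable def relations (v : M → V) (S : Finset M) : Submodule ℚ (M →₀ ℚ) :=
  Finsupp.supported ℚ ℚ (S : Set M) ⊓ LinearMap.ker (Finsupp.linearCombination ℚ v)

theorem mem_relations {v : M → V} {S : Finset M} {a : M →₀ ℚ} :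
    a ∈ relations v S ↔ a.support ⊆ S ∧ Finsupp.linearCombination ℚ v a = 0 := by
  simp [relations, Finsupp.mem_supported]

theorem relations_mono (v : M → V) {S T : Finset M} (h : S ⊆ T) :
    relations v S ≤ relations v T := fun a ha => by
  rw [mem_relations] at ha ⊢
  exact ⟨ha.1.trans h, ha.2⟩

instance finiteDimensional_supported (S : Finset M) :
    FiniteDimensional ℚ (Finsupp.supported ℚ ℚ (S : Set M)) :=
  Module.Finite.equiv (Finsupp.supportedEquivFinsupp (S : Set M)).symm

instance finiteDimensional_relations (v : M → V) (S : Finset M) :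
    FiniteDimensional ℚ (relations v S) :=
  Submodule.finiteDimensional_inf_left _ _

theorem finrank_relations_add_finrank_span (v : M → V) (S : Finset M) :
    finrank ℚ (relations v S) + finrank ℚ (Submodule.span ℚ (v '' S)) = S.card := by
  have h := LinearMap.finrank_range_add_finrank_ker
    ((Finsupp.linearCombination ℚ v).domRestrict (Finsupp.supported ℚ ℚ (S : Set M)))
  rw [LinearMap.range_domRestrict, ← Finsupp.span_image_eq_map_linearCombination,
    LinearEquiv.finrank_eq (Finsupp.supportedEquivFinsupp (S : Set M)), finrank_finsupp_self,
    LinearMap.ker_domRestrict] at h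
  rw [relations, ← Submodule.map_comap_subtype, Submodule.finrank_map_subtype_eq, add_comm]
  simpa using h

theorem finrank_relations_mono (v : M → V) {S T : Finset M} (h : S ⊆ T) :
    finrank ℚ (relations v S) ≤ finrank ℚ (relations v T) :=
  Submodule.finrank_mono (relations_mono v h)

theorem finrank_relations_lt {v : M → V} {S T : Finset M} (h : S ⊂ T) (hT : PosDep v T) :
    finrank ℚ (relations v S) < finrank ℚ (relations v T) := by
  obtain ⟨a, -, ha, ha'⟩ := hT
  refine Submodule.finrank_lt_finrank_of_lt (lt_of_le_of_ne (relations_mono v h.1) fun he => h.2 ?_)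
  have : a ∈ relations v S := he ▸ mem_relations.2 ⟨ha.le, ha'⟩
  exact ha ▸ (mem_relations.1 this).1

theorem PosDep.empty (v : M → V) : PosDep v ∅ := ⟨0, by simp, by simp, by simp⟩

theorem PosDep.union [DecidableEq M] {v : M → V} {S T : Finset M} (hS : PosDep v S)
    (hT : PosDep v T) : PosDep v (S ∪ T) := by
  obtain ⟨a, ha, rfl, ha'⟩ := hS
  obtain ⟨b, hb, rfl, hb'⟩ := hT
  refine ⟨a + b, fun m => add_nonneg (ha m) (hb m), ?_, by simp [ha', hb']⟩
  ext m
  have := ha m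
  have := hb m
  simp only [Finsupp.mem_support_iff, Finset.mem_union, Finsupp.add_apply, ne_eq]
  rw [add_eq_zero_iff_of_nonneg (ha m) (hb m)]
  tauto

/-- A nonempty positively dependent set contains a positively dependent proper subset whose
relations have codimension at most one: the faces of a polyhedral cone have facets. -/
theorem PosDep.exists_ssubset {v : M → V} {S : Finset M} (hS : PosDep v S) (hne : S.Nonempty) :
    ∃ T ⊂ S, PosDep v T ∧ finrank ℚ (relations v S) ≤ finrank ℚ (relations v T) + 1 := by
  classical
  obtain ⟨T, hT, hmax⟩ := Finset.exists_max_image (S.ssubsets.filter (PosDep v)) Finset.card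
    ⟨∅, by simp [PosDep.empty, Finset.mem_ssubsets, hne, Finset.empty_ssubset]⟩
  simp only [Finset.mem_filter, Finset.mem_ssubsets] at hT hmax
  obtain ⟨hTS, hT⟩ := hT
  refine ⟨T, hTS, hT, ?_⟩
  obtain ⟨a, ha, haS, ha'⟩ := hS
  obtain ⟨t, ht, htT, ht'⟩ := hT
  suffices hle : relations v S ≤ relations v T ⊔ Submodule.span ℚ {a} by
    calc finrank ℚ (relations v S) ≤ _ := Submodule.finrank_mono hle
      _ ≤ finrank ℚ (relations v T) + finrank ℚ (Submodule.span ℚ {a}) :=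
        Submodule.finrank_add_le_finrank_add_finrank _ _
      _ ≤ _ := by
        gcongr
        exact (finrank_span_le_card {a}).trans (by simp)
  intro b hb
  rw [mem_relations] at hb
  have hpos : ∀ m ∈ S, 0 < a m := fun m hm =>
    lt_of_le_of_ne (ha m) (Finsupp.mem_support_iff.1 (haS ▸ hm)).symm
  have htpos : ∀ m ∈ T, 0 < t m := fun m hm =>
    lt_of_le_of_ne (ht m) (Finsupp.mem_support_iff.1 (htT ▸ hm)).symm
  have htzero : ∀ m, m ∉ T → t m = 0 := fun m hm => Finsupp.notMem_support_iff.1 (htT ▸ hm)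
  -- The minimal ratio gives the largest multiple of `a` that can be subtracted from `b` while
  -- staying nonnegative off `T`; the result vanishes at `m₀`.
  obtain ⟨m₀, hm₀, hmin⟩ := Finset.exists_min_image (S \ T) (fun m => b m / a m)
    (Finset.sdiff_nonempty.2 hTS.2)
  rw [Finset.mem_sdiff] at hm₀
  set c : M →₀ ℚ := b - (b m₀ / a m₀) • a with hc
  have hcrel : Finsupp.linearCombination ℚ v c = 0 := by simp [hc, hb.2, ha']
  have hcS : ∀ m, m ∉ S → c m = 0 := fun m hm => by
    have h1 : b m = 0 := Finsupp.notMem_support_iff.1 fun h => hm (hb.1 h)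
    have h2 : a m = 0 := Finsupp.notMem_support_iff.1 (haS ▸ hm)
    simp [hc, h1, h2]
  have hc0 : c m₀ = 0 := by
    have := (hpos m₀ hm₀.1).ne'
    simp [hc]
    field_simp
    simp
  have hcnn : ∀ m, m ∉ T → 0 ≤ c m := fun m hm => by
    by_cases hmS : m ∈ S
    · have h := hmin m (Finset.mem_sdiff.2 ⟨hmS, hm⟩)
      rw [le_div_iff₀ (hpos m hmS)] at h
      simpa [hc] using h
    · exact (hcS m hmS).ge
  obtain ⟨s, hs⟩ : ∃ s : ℚ, ∀ m ∈ T, 0 < c m + s * t m := by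
    obtain ⟨s, hs⟩ := (T.image fun m => - c m / t m).exists_le
    refine ⟨s + 1, fun m hm => ?_⟩
    have h := hs _ (Finset.mem_image_of_mem _ hm)
    rw [div_le_iff₀ (htpos m hm)] at h
    linarith [htpos m hm]
  -- Otherwise `c`, made positive on `T` by adding a multiple of `t`, has support strictly between
  -- `T` and `S`, against the maximality of `T`.
  have hcT : c.support ⊆ T := by
    by_contra hcT
    obtain ⟨m₁, hm₁, hm₁T⟩ := Finset.not_subset.1 hcT
    have happly : ∀ m, m ∉ T → (c + s • t) m = c m := fun m hm => by simp [htzero m hm]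
    have hsup : T ⊂ (c + s • t).support := by
      refine ⟨fun m hm => ?_, fun h => hm₁T (h ?_)⟩
      · simpa using (hs m hm).ne'
      · rw [Finsupp.mem_support_iff, happly m₁ hm₁T]
        exact Finsupp.mem_support_iff.1 hm₁
    have hsub : (c + s • t).support ⊂ S := by
      refine ⟨fun m hm => ?_, fun h => ?_⟩
      · by_contra hmS
        have hmT : m ∉ T := fun h => hmS (hTS.1 h)
        rw [Finsupp.mem_support_iff, happly m hmT] at hm
        exact hm (hcS m hmS)
      · have := h hm₀.1
        rw [Finsupp.mem_support_iff, happly m₀ hm₀.2] at this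
        exact this hc0
    refine absurd (hmax _ ⟨hsub, c + s • t, fun m => ?_, rfl, by simp [hcrel, ht']⟩)
      (not_le.2 (Finset.card_lt_card hsup))
    by_cases hm : m ∈ T
    · simpa using (hs m hm).le
    · rw [happly m hm]
      exact hcnn m hm
  have : b = c + (b m₀ / a m₀) • a := by simp [hc]
  rw [this]
  exact Submodule.add_mem_sup (mem_relations.2 ⟨hcT, hcrel⟩)
    (Submodule.smul_mem _ _ (Submodule.mem_span_singleton_self a))

theorem finrank_relations_union_le [DecidableEq M] [FiniteDimensional ℚ V] (v : M → V)
    (S T : Finset M) :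
    finrank ℚ (relations v (S ∪ T)) ≤
      finrank ℚ (relations v S) + finrank ℚ (relations v T) + finrank ℚ V := by
  have h1 := finrank_relations_add_finrank_span v S
  have h2 := finrank_relations_add_finrank_span v T
  have h3 := finrank_relations_add_finrank_span v (S ∪ T)
  have h4 := Finset.card_union_le S T
  have h5 := Submodule.finrank_le (Submodule.span ℚ (v '' S))
  have h6 : finrank ℚ (Submodule.span ℚ (v '' T)) ≤
      finrank ℚ (Submodule.span ℚ (v '' (S ∪ T : Finset M))) :=
    Submodule.finrank_mono (Submodule.span_mono (Set.image_mono (by simp)))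
  omega

theorem finrank_relations_union_of_disjoint [DecidableEq M] {v : M → V}
    {S T : Finset M} (h : Disjoint S T) (hS : Submodule.span ℚ (v '' S) = ⊤)
    (hT : Submodule.span ℚ (v '' T) = ⊤) :
    finrank ℚ (relations v (S ∪ T)) =
      finrank ℚ (relations v S) + finrank ℚ (relations v T) + finrank ℚ V := by
  have h1 := finrank_relations_add_finrank_span v S
  have h2 := finrank_relations_add_finrank_span v T
  have h3 := finrank_relations_add_finrank_span v (S ∪ T)
  have h4 := Finset.card_union_of_disjoint h
  have h6 : Submodule.span ℚ (v '' (S ∪ T : Finset M)) = ⊤ :=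
    top_le_iff.1 (hS ▸ Submodule.span_mono (Set.image_mono (by simp)))
  rw [hS, finrank_top] at h1
  rw [hT, finrank_top] at h2
  rw [h6, finrank_top] at h3
  omega

end PositiveDependence

/-! ### Order invariance of the dimensions -/

section OrderIso

variable {M V M' V' : Type*} [AddCommGroup V] [Module ℚ V] [AddCommGroup V'] [Module ℚ V']

/-- The poset, under inclusion, of the nonempty positively dependent finite sets. -/
abbrev PosDepSets (v : M → V) : Type _ := {S : Finset M // S.Nonempty ∧ PosDep v S}

/-- Passing to a facet loses at most one dimension on the left, while its image, being strictly
smaller, loses at least one on the right. Applied to `e.symm` as well, this gives equality. -/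
theorem finrank_relations_le_orderIso {v : M → V} {v' : M' → V'}
    (e : PosDepSets v ≃o PosDepSets v') (S : PosDepSets v) :
    finrank ℚ (relations v S.1) ≤ finrank ℚ (relations v' (e S).1) := by
  induction hn : S.1.card using Nat.strong_induction_on generalizing S with
  | _ n ih =>
    obtain ⟨T, hTS, hT, hle⟩ := S.2.2.exists_ssubset S.2.1
    refine hle.trans ?_
    rcases T.eq_empty_or_nonempty with rfl | hne
    · have h0 : finrank ℚ (relations v ∅) = 0 := by
        have := finrank_relations_add_finrank_span v ∅
        simp only [Finset.card_empty] at this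
        omega
      have := finrank_relations_lt (Finset.empty_ssubset.2 (e S).2.1) (e S).2.2
      omega
    · have hlt : (⟨T, hne, hT⟩ : PosDepSets v) < S := hTS
      have h1 := ih _ (hn ▸ Finset.card_lt_card hTS) ⟨T, hne, hT⟩ rfl
      have h2 := finrank_relations_lt (e.lt_iff_lt.2 hlt) (e S).2.2
      simp only at h1
      omega

/-- If every finite set of indices misses a positively dependent spanning set, then the dimension
of `V` is bounded by that of any other space realizing the same poset. -/
theorem finrank_le_of_orderIso [FiniteDimensional ℚ V'] {v : M → V} {v' : M' → V'}
    (e : PosDepSets v ≃o PosDepSets v')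
    (H : ∀ S : Finset M, ∃ T, Disjoint S T ∧ PosDep v T ∧ Submodule.span ℚ (v '' T) = ⊤) :
    finrank ℚ V ≤ finrank ℚ V' := by
  classical
  rcases Nat.eq_zero_or_pos (finrank ℚ V) with h0 | hpos
  · omega
  have hne : ∀ T : Finset M, Submodule.span ℚ (v '' T) = ⊤ → T.Nonempty := fun T hT => by
    by_contra hT'
    rw [Finset.not_nonempty_iff_eq_empty] at hT'
    subst hT'
    have := finrank_relations_add_finrank_span v ∅
    rw [hT, finrank_top, Finset.card_empty] at this
    omega
  obtain ⟨S, -, hS, hS'⟩ := H ∅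
  obtain ⟨T, hdisj, hT, hT'⟩ := H S
  have heq := finrank_relations_union_of_disjoint hdisj hS' hT'
  let S₁ : PosDepSets v := ⟨S, hne S hS', hS⟩
  let T₁ : PosDepSets v := ⟨T, hne T hT', hT⟩
  let U₁ : PosDepSets v := ⟨S ∪ T, (hne S hS').mono Finset.subset_union_left, hS.union hT⟩
  let W : PosDepSets v' := ⟨(e S₁).1 ∪ (e T₁).1, (e S₁).2.1.mono Finset.subset_union_left,
    (e S₁).2.2.union (e T₁).2.2⟩
  -- `U₁` is the join of `S₁` and `T₁`, so its image lies below any upper bound of their images.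
  have hW : e U₁ ≤ W := by
    rw [← e.le_symm_apply]
    have h1 : S₁ ≤ e.symm W := by
      rw [e.le_symm_apply]; exact Finset.subset_union_left
    have h2 : T₁ ≤ e.symm W := by
      rw [e.le_symm_apply]; exact Finset.subset_union_right
    exact Finset.union_subset h1 h2
  have h1 : finrank ℚ (relations v (S ∪ T)) ≤ _ := finrank_relations_le_orderIso e U₁
  have h2 := finrank_relations_mono v' hW
  have h3 := finrank_relations_union_le v' (e S₁).1 (e T₁).1
  have h4 := finrank_relations_le_orderIso e.symm (e S₁)
  have h5 := finrank_relations_le_orderIso e.symm (e T₁)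
  rw [e.symm_apply_apply] at h4 h5
  simp only [W, S₁, T₁] at *
  omega

end OrderIso
-- Finitely generated abelian groups modulo torsion
theorem CommGroup.exists_hom_of_fg (G : Type*) [CommGroup G] (hG : Group.FG G) :
    ∃ n : ℕ, Nonempty ((G ⧸ CommGroup.torsion G) ≃* Multiplicative (Fin n → ℤ)) ∧
      ∃ φ : G →* Multiplicative (Fin n → ℚ), (∀ g, φ g = 1 → IsOfFinOrder g) ∧
        ∀ i, ∃ g, φ g = Multiplicative.ofAdd (Pi.single i 1) := by
  let A := Additive (G ⧸ CommGroup.torsion G)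
  let b := Module.finBasis ℤ A
  let f : A ≃+ (Fin (finrank ℤ A) → ℤ) := b.equivFun.toAddEquiv
  refine ⟨finrank ℤ A, ⟨AddEquiv.toMultiplicativeRight f⟩, ?_⟩
  let c : (Fin (finrank ℤ A) → ℤ) →+ (Fin (finrank ℤ A) → ℚ) :=
    (Int.castAddHom ℚ).compLeft _
  have hc : Function.Injective c := fun x y h => funext fun i => by
    simpa [c] using congrFun h i
  let ψ : A →+ (Fin (finrank ℤ A) → ℚ) := c.comp f.toAddMonoidHom
  refine ⟨(AddMonoidHom.toMultiplicativeRight ψ).comp (QuotientGroup.mk' _), fun g hg => ?_,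
    fun i => ?_⟩
  · have h : ψ (Additive.ofMul (g : G ⧸ CommGroup.torsion G)) = 0 := hg
    have h' : Additive.ofMul (g : G ⧸ CommGroup.torsion G) = 0 := by
      apply f.injective
      apply hc
      simpa [ψ] using h
    exact (QuotientGroup.eq_one_iff g).1 h'
  · obtain ⟨g, hg⟩ := QuotientGroup.mk_surjective (f.symm (Pi.single i 1)).toMul
    refine ⟨g, ?_⟩
    change Multiplicative.ofAdd (ψ (Additive.ofMul (g : G ⧸ CommGroup.torsion G))) = _
    congr 1
    change c (f (Additive.ofMul (g : G ⧸ CommGroup.torsion G))) = _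
    rw [hg, ofMul_toMul, f.apply_symm_apply]
    ext j
    simp [c, Pi.single_apply]

/-! ### Prime factorization, ideal classes and prime supports -/

section Dedekind

variable {D : Type*} [CommRing D] [IsDedekindDomain D]

/-- The ideal with the prescribed prime factorization. -/
noncomputable def primeProd (a : HeightOneSpectrum D →₀ ℕ) : Ideal D :=
  a.prod fun m k => m.asIdeal ^ k

theorem primeProd_ne_bot (a : HeightOneSpectrum D →₀ ℕ) : primeProd a ≠ ⊥ :=
  Finset.prod_ne_zero_iff.2 fun m _ => pow_ne_zero _ m.ne_bot

omit [IsDedekindDomain D] in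
theorem primeProd_add (a b : HeightOneSpectrum D →₀ ℕ) :
    primeProd (a + b) = primeProd a * primeProd b := by
  classical
  exact Finsupp.prod_add_index' (by simp) (fun m k l => pow_add _ k l)

theorem primeProd_le_iff {a : HeightOneSpectrum D →₀ ℕ} {m : HeightOneSpectrum D} :
    primeProd a ≤ m.asIdeal ↔ m ∈ a.support := by
  constructor
  · intro h
    obtain ⟨p, hp, hle⟩ := (Ideal.IsPrime.prod_le m.isPrime).1 h
    have hle' : p.asIdeal ≤ m.asIdeal := m.isPrime.le_of_pow_le hle
    have : p = m := HeightOneSpectrum.ext (p.isMaximal.eq_of_le m.isPrime.ne_top hle')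
    exact this ▸ hp
  · intro h
    exact (Ideal.IsPrime.prod_le m.isPrime).2
      ⟨m, h, Ideal.pow_le_self (Finsupp.mem_support_iff.1 h)⟩

theorem exists_primeProd_eq {I : Ideal D} (hI : I ≠ ⊥) :
    ∃ a : HeightOneSpectrum D →₀ ℕ, primeProd a = I := by
  induction I using UniqueFactorizationMonoid.induction_on_prime with
  | h₁ => exact absurd rfl hI
  | h₂ I h => exact ⟨0, by rw [Ideal.isUnit_iff.1 h]; simp [primeProd]⟩
  | h₃ I P hI0 hP ih =>
    obtain ⟨a, rfl⟩ := ih hI0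
    refine ⟨Finsupp.single ⟨P, Ideal.isPrime_of_prime hP, hP.ne_zero⟩ 1 + a, ?_⟩
    rw [primeProd_add]
    simp [primeProd]

/-- The class of `primeProd a` in the class group. -/
noncomputable def primeClass (a : HeightOneSpectrum D →₀ ℕ) : ClassGroup D :=
  ClassGroup.mk0 ⟨primeProd a, mem_nonZeroDivisors_of_ne_zero (primeProd_ne_bot a)⟩

theorem primeClass_add (a b : HeightOneSpectrum D →₀ ℕ) :
    primeClass (a + b) = primeClass a * primeClass b := by
  simp_rw [primeClass, ← map_mul]
  congr 1
  exact Subtype.ext (primeProd_add a b)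

theorem primeClass_zero : primeClass (0 : HeightOneSpectrum D →₀ ℕ) = 1 := by
  have := primeClass_add (0 : HeightOneSpectrum D →₀ ℕ) 0
  simpa using this

theorem primeClass_eq_one_iff {a : HeightOneSpectrum D →₀ ℕ} :
    primeClass a = 1 ↔ ∃ x : D, x ≠ 0 ∧ primeProd a = Ideal.span {x} := by
  rw [primeClass, ClassGroup.mk0_eq_one_iff]
  constructor
  · rintro ⟨x, hx⟩
    refine ⟨x, ?_, hx⟩
    rintro rfl
    exact primeProd_ne_bot a (by simpa using hx)
  · rintro ⟨x, -, hx⟩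
    exact ⟨x, hx⟩

/-- Every ideal class contains an integral ideal that is prime to a given finite set of primes. -/
theorem exists_primeClass_eq_disjoint (c : ClassGroup D) (S : Finset (HeightOneSpectrum D)) :
    ∃ a : HeightOneSpectrum D →₀ ℕ, primeClass a = c ∧ Disjoint S a.support := by
  classical
  obtain ⟨⟨J, hJ⟩, hJc⟩ := ClassGroup.mk0_surjective c⁻¹
  have hJ0 : J ≠ ⊥ := nonZeroDivisors.ne_zero hJ
  let K : Ideal D := primeProd (Finsupp.indicator S fun _ _ => 1)
  have hK0 : K ≠ ⊥ := primeProd_ne_bot _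
  -- Writing (x) = JI, the equality JK + (x) = J cancels to K + I = 1, so I is prime to `S`, and its
  -- class is inverse to that of J. If x = 0, then K = 1 and `S` is empty.
  obtain ⟨x, hx⟩ := IsDedekindDomain.exists_sup_span_eq (Ideal.mul_le_left : J * K ≤ J)
    (mul_ne_zero hJ0 hK0)
  rcases eq_or_ne x 0 with rfl | hx0
  · have hK : K = 1 := by
      have : J * K = J * 1 := by simpa using hx
      exact mul_left_cancel₀ hJ0 this
    obtain ⟨⟨I, hI⟩, hIc⟩ := ClassGroup.mk0_surjective c
    obtain ⟨a, rfl⟩ := exists_primeProd_eq (nonZeroDivisors.ne_zero hI)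
    refine ⟨a, hIc, ?_⟩
    rw [Finset.disjoint_left]
    intro m hm
    have : K ≤ m.asIdeal := primeProd_le_iff.2 (by simp [Finsupp.indicator_apply, hm])
    rw [hK, Ideal.one_eq_top] at this
    exact absurd (top_le_iff.1 this) m.isPrime.ne_top
  · have hxJ : Ideal.span {x} ≤ J := hx ▸ le_sup_right
    obtain ⟨I, hI⟩ := Ideal.dvd_iff_le.2 hxJ
    have hI0 : I ≠ ⊥ := by
      rintro rfl
      simp [hx0] at hI
    obtain ⟨a, rfl⟩ := exists_primeProd_eq hI0
    refine ⟨a, ?_, ?_⟩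
    · have h1 : ClassGroup.mk0 ⟨J, hJ⟩ * primeClass a = 1 := by
        rw [primeClass, ← map_mul]
        exact (ClassGroup.mk0_eq_one_iff _).2 ⟨x, hI.symm⟩
      rw [hJc] at h1
      exact (inv_mul_eq_one.1 h1).symm
    · rw [Finset.disjoint_left]
      intro m hm hma
      have hK : K ⊔ primeProd a = 1 := by
        apply mul_left_cancel₀ hJ0
        rw [Ideal.mul_sup, ← hI, hx, mul_one]
      have h1 : K ≤ m.asIdeal := primeProd_le_iff.2 (by simp [Finsupp.indicator_apply, hm])
      have h2 := sup_le h1 (primeProd_le_iff.2 hma)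
      rw [hK, Ideal.one_eq_top] at h2
      exact m.isPrime.ne_top (top_le_iff.1 h2)

/-- The set of height one primes containing a nonzero ideal. -/
noncomputable def primeSupport (I : Ideal D) : Finset (HeightOneSpectrum D) :=
  if h : I = ⊥ then ∅ else (Ideal.finite_factors h).toFinset

theorem mem_primeSupport {I : Ideal D} (hI : I ≠ ⊥) {m : HeightOneSpectrum D} :
    m ∈ primeSupport I ↔ I ≤ m.asIdeal := by
  simp [primeSupport, hI, Ideal.dvd_iff_le]

theorem primeSupport_primeProd (a : HeightOneSpectrum D →₀ ℕ) :
    primeSupport (primeProd a) = a.support := by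
  ext m
  rw [mem_primeSupport (primeProd_ne_bot a), primeProd_le_iff]

theorem primeSupport_radical {I : Ideal D} (hI : I ≠ ⊥) :
    primeSupport I.radical = primeSupport I := by
  ext m
  have hI' : I.radical ≠ ⊥ := fun h => hI (le_bot_iff.1 (h ▸ Ideal.le_radical))
  rw [mem_primeSupport hI', mem_primeSupport hI, m.isPrime.radical_le_iff]

theorem primeSupport_subset_iff {I J : Ideal D} (hI : I ≠ ⊥) (hJ : J ≠ ⊥) (hr : J.IsRadical) :
    primeSupport J ⊆ primeSupport I ↔ I ≤ J := by
  constructor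
  · intro h
    rw [← hr.radical, Ideal.radical_eq_sInf]
    refine le_sInf ?_
    rintro P ⟨hJP, hP⟩
    have hP0 : P ≠ ⊥ := fun h => hJ (le_bot_iff.1 (h ▸ hJP))
    exact (mem_primeSupport hI).1 (h ((mem_primeSupport (m := ⟨P, hP, hP0⟩) hJ).2 hJP))
  · intro h m hm
    rw [mem_primeSupport hJ] at hm
    exact (mem_primeSupport hI).2 (h.trans hm)

theorem primeSupport_nonempty_iff {I : Ideal D} (hI : I ≠ ⊥) :
    (primeSupport I).Nonempty ↔ I ≠ ⊤ := by
  constructor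
  · rintro ⟨m, hm⟩ rfl
    exact m.isPrime.ne_top (top_le_iff.1 ((mem_primeSupport hI).1 hm))
  · intro h
    obtain ⟨P, hP, hle⟩ := Ideal.exists_le_maximal I h
    have hP0 : P ≠ ⊥ := fun h => hI (le_bot_iff.1 (h ▸ hle))
    exact ⟨⟨P, hP.isPrime, hP0⟩, (mem_primeSupport hI).2 hle⟩

end Dedekind

/-! ### Principal ideals as positive relations between prime classes -/

section PrimeVectors

variable {D : Type*} [CommRing D] [IsDedekindDomain D]

/-- The classes of the primes, as vectors. -/
noncomputable def primeVector {V : Type*} [AddCommGroup V] (φ : ClassGroup D →* Multiplicative V)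
    (m : HeightOneSpectrum D) : V :=
  (φ (primeClass (Finsupp.single m 1))).toAdd

variable {V : Type*} [AddCommGroup V] [Module ℚ V] (φ : ClassGroup D →* Multiplicative V)

theorem linearCombination_primeVector (a : HeightOneSpectrum D →₀ ℕ) :
    Finsupp.linearCombination ℚ (primeVector φ) (a.mapRange (Nat.castAddMonoidHom ℚ) (map_zero _)) =
      (φ (primeClass a)).toAdd := by
  let f : (HeightOneSpectrum D →₀ ℕ) →+ V :=
    (Finsupp.linearCombination ℚ (primeVector φ)).toAddMonoidHom.comp
      (Finsupp.mapRange.addMonoidHom (Nat.castAddMonoidHom ℚ))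
  let g : (HeightOneSpectrum D →₀ ℕ) →+ V :=
    { toFun := fun a => (φ (primeClass a)).toAdd
      map_zero' := by simp [primeClass_zero]
      map_add' := fun a b => by simp [primeClass_add] }
  have h : f = g := by
    ext m
    simp [f, g, primeVector]
  exact DFunLike.congr_fun h a

theorem posDep_primeVector_of_primeClass_eq_one {a : HeightOneSpectrum D →₀ ℕ}
    (h : primeClass a = 1) : PosDep (primeVector φ) a.support := by
  refine ⟨a.mapRange (Nat.castAddMonoidHom ℚ) (map_zero _), by simp, ?_, ?_⟩
  · ext m
    simp
  · rw [linearCombination_primeVector, h, map_one, toAdd_one]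

theorem exists_nat_relation {M : Type*} {v : M → V} {S : Finset M} (h : PosDep v S) :
    ∃ a : M →₀ ℕ, a.support = S ∧
      Finsupp.linearCombination ℚ v (a.mapRange (Nat.castAddMonoidHom ℚ) (map_zero _)) = 0 := by
  classical
  obtain ⟨b, hb, rfl, hb'⟩ := h
  let N : ℕ := ∏ m ∈ b.support, (b m).den
  have hN : (N : ℚ) ≠ 0 := by
    exact_mod_cast Finset.prod_ne_zero_iff.2 fun m _ => (b m).den_ne_zero
  have hex : ∀ m, ∃ k : ℕ, (k : ℚ) = N * b m := fun m => by
    by_cases hm : m ∈ b.support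
    · obtain ⟨q, hq⟩ := Finset.dvd_prod_of_mem (fun m => (b m).den) hm
      refine ⟨q * (b m).num.toNat, ?_⟩
      have h1 : (((b m).num.toNat : ℤ) : ℚ) = (b m).num := by
        rw [Int.toNat_of_nonneg (Rat.num_nonneg.2 (hb m))]
      have h2 : (N : ℚ) = (b m).den * q := by exact_mod_cast hq
      have h3 := Rat.den_mul_eq_num (b m)
      push_cast at h1 ⊢
      rw [h1, h2, ← h3]
      ring
    · exact ⟨0, by simp [Finsupp.notMem_support_iff.1 hm]⟩
  choose k hk using hex
  have hsupp : ∀ m, k m ≠ 0 ↔ m ∈ b.support := fun m => by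
    rw [Finsupp.mem_support_iff, ← Nat.cast_ne_zero (R := ℚ), hk]
    simp [hN]
  refine ⟨Finsupp.onFinset b.support k fun m hm => (hsupp m).1 hm, ?_, ?_⟩
  · ext m
    rw [Finsupp.mem_support_iff, Finsupp.onFinset_apply, hsupp]
  · convert congrArg ((N : ℚ) • ·) hb' using 1
    · rw [← map_smul]
      congr 1
      ext m
      simp [hk]
    · simp

variable {φ}

theorem exists_isRadical_of_posDep (hφ : ∀ g, φ g = 1 → IsOfFinOrder g)
    {S : Finset (HeightOneSpectrum D)} (h : PosDep (primeVector φ) S) :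
    ∃ x : D, x ≠ 0 ∧ primeSupport (Ideal.span {x}) = S := by
  obtain ⟨a, rfl, ha⟩ := exists_nat_relation h
  rw [linearCombination_primeVector] at ha
  -- The relation only makes the class torsion; a positive multiple of `a` is principal and has the
  -- same support.
  obtain ⟨k, hk, hk'⟩ := isOfFinOrder_iff_pow_eq_one.1 (hφ _ (toAdd_eq_zero.1 ha))
  have hpow : ∀ k : ℕ, primeClass (k • a) = primeClass a ^ k := fun k => by
    induction k with
    | zero => simp [primeClass_zero]
    | succ k ih => rw [succ_nsmul, primeClass_add, ih, pow_succ]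
  obtain ⟨x, hx0, hx⟩ := primeClass_eq_one_iff.1 ((hpow k).trans hk')
  refine ⟨x, hx0, ?_⟩
  rw [← hx, primeSupport_primeProd]
  ext m
  simp [hk.ne']

theorem posDep_primeSupport_span (φ : ClassGroup D →* Multiplicative V) {x : D} (hx : x ≠ 0) :
    PosDep (primeVector φ) (primeSupport (Ideal.span {x})) := by
  obtain ⟨a, ha⟩ := exists_primeProd_eq (I := Ideal.span {x}) (by simpa using hx)
  rw [← ha, primeSupport_primeProd]
  exact posDep_primeVector_of_primeClass_eq_one φ (primeClass_eq_one_iff.2 ⟨x, hx, ha⟩)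

/-- The poset of principal radicals is, up to reversal, the poset of nonempty finite sets of primes
whose classes are positively dependent. -/
theorem nonempty_principalRadicals_orderIso (hφ : ∀ g, φ g = 1 → IsOfFinOrder g) :
    Nonempty (principalRadicals D ≃o (PosDepSets (primeVector φ))ᵒᵈ) := by
  have hspan : ∀ {x : D}, x ≠ 0 → Ideal.span {x} ≠ ⊥ := fun hx => by simpa using hx
  have hbot : ∀ I : principalRadicals D, I.1 ≠ ⊥ := by
    intro I h
    obtain ⟨x, hx, hI⟩ := I.2.2
    exact hspan hx (le_bot_iff.1 (h ▸ hI ▸ Ideal.le_radical))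
  let f : principalRadicals D → (PosDepSets (primeVector φ))ᵒᵈ := fun I =>
    OrderDual.toDual ⟨primeSupport I.1, (primeSupport_nonempty_iff (hbot I)).2 I.2.1, by
      obtain ⟨x, hx, hI⟩ := I.2.2
      rw [hI, primeSupport_radical (hspan hx)]
      exact posDep_primeSupport_span φ hx⟩
  have hf : ∀ I J, f I ≤ f J ↔ I ≤ J := fun I J => by
    obtain ⟨x, hx, hJ⟩ := J.2.2
    exact primeSupport_subset_iff (hbot I) (hbot J) (hJ ▸ Ideal.radical_isRadical _)
  refine ⟨RelIso.ofSurjective (OrderEmbedding.ofMapLEIff f hf) ?_⟩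
  intro S
  obtain ⟨x, hx, hS⟩ := exists_isRadical_of_posDep hφ (OrderDual.ofDual S).2.2
  rw [← primeSupport_radical (hspan hx)] at hS
  have hb : (Ideal.span {x}).radical ≠ ⊥ :=
    fun h => hspan hx (le_bot_iff.1 (h ▸ Ideal.le_radical))
  refine ⟨⟨(Ideal.span {x}).radical, ?_, x, hx, rfl⟩, ?_⟩
  · rw [← primeSupport_nonempty_iff hb, hS]
    exact (OrderDual.ofDual S).2.1
  · exact congrArg OrderDual.toDual (Subtype.ext hS)

theorem exists_disjoint_posDep_span_eq_top {n : ℕ}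
    {φ : ClassGroup D →* Multiplicative (Fin n → ℚ)}
    (hφ : ∀ i, ∃ g, φ g = Multiplicative.ofAdd (Pi.single i 1))
    (S : Finset (HeightOneSpectrum D)) :
    ∃ T, Disjoint S T ∧ PosDep (primeVector φ) T ∧
      Submodule.span ℚ (primeVector φ '' T) = ⊤ := by
  classical
  choose g hg using hφ
  choose a ha ha' using fun i => exists_primeClass_eq_disjoint (g i) S
  -- The inverse class makes `a i + b i` principal, hence its support positively dependent, while `a
  -- i` alone yields the `i`-th basis vector.
  choose b hb hb' using fun i => exists_primeClass_eq_disjoint (g i)⁻¹ S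
  have hab : ∀ i, PosDep (primeVector φ) (a i + b i).support := fun i =>
    posDep_primeVector_of_primeClass_eq_one φ (by rw [primeClass_add, ha, hb, mul_inv_cancel])
  have hU : ∀ s : Finset (Fin n),
      PosDep (primeVector φ) (s.biUnion fun i => (a i + b i).support) := fun s => by
    induction s using Finset.induction_on with
    | empty => exact PosDep.empty _
    | insert i s _ ih => rw [Finset.biUnion_insert]; exact (hab i).union ih
  refine ⟨Finset.univ.biUnion fun i => (a i + b i).support, ?_, hU _, ?_⟩
  · rw [Finset.disjoint_biUnion_right]
    intro i _
    exact (Finset.disjoint_union_right.2 ⟨ha' i, hb' i⟩).mono_right Finsupp.support_add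
  · rw [← top_le_iff, ← (Pi.basisFun ℚ (Fin n)).span_eq, Submodule.span_le]
    rintro _ ⟨i, rfl⟩
    have h := linearCombination_primeVector φ (a i)
    rw [ha, hg, toAdd_ofAdd] at h
    rw [Pi.basisFun_apply, ← h, Finsupp.span_image_eq_map_linearCombination]
    refine Submodule.mem_map_of_mem ((Finsupp.mem_supported _ _).2 fun m hm => ?_)
    simp only [Finset.coe_biUnion, Set.mem_iUnion]
    refine ⟨i, by simp, ?_⟩
    simp at hm ⊢
    tauto

end PrimeVectors

/-! ### Comparison of the ranks -/

theorem mainTheorem4 {D : Type*} {D' : Type*}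
    [CommRing D] [IsDedekindDomain D] [CommRing D'] [IsDedekindDomain D']
    (h : Nonempty (principalRadicals D ≃o principalRadicals D'))
    (hD : Group.FG (ClassGroup D)) (hD' : Group.FG (ClassGroup D')) :
    Nonempty ((ClassGroup D ⧸ CommGroup.torsion (ClassGroup D)) ≃*
      (ClassGroup D' ⧸ CommGroup.torsion (ClassGroup D'))) := by
  obtain ⟨e⟩ := h
  obtain ⟨n, ⟨f⟩, φ, hφ, hsurj⟩ := CommGroup.exists_hom_of_fg _ hD
  obtain ⟨n', ⟨f'⟩, φ', hφ', hsurj'⟩ := CommGroup.exists_hom_of_fg _ hD'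
  obtain ⟨i⟩ := nonempty_principalRadicals_orderIso hφ
  obtain ⟨i'⟩ := nonempty_principalRadicals_orderIso hφ'
  let E : PosDepSets (primeVector φ) ≃o PosDepSets (primeVector φ') :=
    ((i.symm.trans e).trans i').dual
  have h1 := finrank_le_of_orderIso E (exists_disjoint_posDep_span_eq_top hsurj)
  have h2 := finrank_le_of_orderIso E.symm (exists_disjoint_posDep_span_eq_top hsurj')
  rw [finrank_fin_fun, finrank_fin_fun] at h1 h2
  obtain rfl := le_antisymm h1 h2
  exact ⟨f.trans f'.symm⟩
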